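/- Let $\Omega\in\mathbb{C}^{L\times L}$ be an indefinite Hermitian matrix (its quadratic form takes both positive and negative values) and let $x\sim\mathbb{CN}(0,I_L)$, i.e. $x$ is a random vector in $\mathbb{C}^L$ with Lebesgue density $\pi^{-L}e^{-x^Hx}$. Let $s^{(1,1)}<s^{(1,2)}<\cdots<s^{(1,n_1)}$ be the distinct positive eigenvalues of $\Omega$, with algebraic multiplicities $m_{1,1},\dots,m_{1,n_1}$, and let $s^{(2,n_2)}<\cdots<s^{(2,2)}<s^{(2,1)}$ be its distinct negative eigenvalues, with algebraic multiplicities $m_{2,n_2},\dots,m_{2,1}$. For $q\in\{1,2\}$ put $$\rho_q=\sum_{i=1}^{n_q}m_{q,i},\qquad C_q=\prod_{i=1}^{n_q}\left(\frac{s^{(q,1)}}{s^{(q,i)}}\right)^{m_{q,i}},\qquad \gamma_{q,k}=\sum_{i=1}^{n_q}\frac{m_{q,i}}{k}\left(1-\frac{s^{(q,1)}}{s^{(q,i)}}\right)^{k}\quad(k\ge 1),$$ $$\delta_{q,0}=1,\qquad \delta_{q,k+1}=\frac{1}{k+1}\sum_{i=1}^{k+1}i\,\gamma_{q,i}\,\delta_{q,k+1-i}\quad(k\ge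 0),\qquad \bar\delta_{q,k}=C_q\,\delta_{q,k}.$$ Then for every $t\ge 0$ $$\mathcal{P}\{x^H\Omega x>t\}=\sum_{k_2=0}^{\infty}\sum_{k_1=0}^{\infty}\bar\delta_{1,k_1}\bar\delta_{2,k_2}\sum_{i=0}^{\rho_1+k_1-1}\frac{e^{-t/|s^{(1,1)}|}}{i!}\left|\frac{s^{(2,1)}}{s^{(1,1)}}\right|^{i}\sum_{l=0}^{i}\binom{i}{l}\left(\frac{t}{|s^{(2,1)}|}\right)^{i-l}\frac{\Gamma(\rho_2+k_2+l)}{\Gamma(\rho_2+k_2)}\left(\frac{|s^{(1,1)}|}{|s^{(1,1)}|+|s^{(2,1)}|}\right)^{\rho_2+k_2+l}$$ (with $0^0=1$), and in particular, for $t=0$, $$\mathcal{P}\{x^H\Omega x>0\}=\sum_{k_2=0}^{\infty}\sum_{k_1=0}^{\infty}\bar\delta_{1,k_1}\bar\delta_{2,k_2}\sum_{i=0}^{\rho_1+k_1-1}\frac{1}{i!}\,\frac{\Gamma(\rho_2+k_2+i)}{\Gamma(\rho_2+k_2)}\left|\frac{s^{(2,1)}}{s^{(1,1)}}\right|^{i}\left(\frac{|s^{(1,1)}|}{|s^{(1,1)}|+|s^{(2,1)}|}\right)^{\rho_2+k_2+i}.$$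 Both double series converge absolutely (as unconditional sums over $(k_1,k_2)\in\mathbb{N}^2$). -/

import Mathlib

open MeasureTheory ProbabilityTheory

/-- The circularly symmetric complex Gaussian law `CN(ν, Σ)` on `ℂⁿ` (for `Σ` positive definite): it
has the density `exp (-(x - ν)ᴴ Σ⁻¹ (x - ν)) / (πⁿ |Σ|)` with respect to Lebesgue measure. -/
noncomputable def complexGaussian {n : ℕ} (ν : Fin n → ℂ) (S : Matrix (Fin n) (Fin n) ℂ) :
    Measure (Fin n → ℂ) :=
  volume.withDensity fun x => ENNReal.ofReal
    (1 / (Real.pi ^ n * ‖S.det‖) *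
      Real.exp (-(star (x - ν) ⬝ᵥ (S⁻¹).mulVec (x - ν)).re))

/-- The value `xᴴ A x`; it is a real number when `A` is Hermitian. -/
noncomputable def hermForm {n : ℕ} (A : Matrix (Fin n) (Fin n) ℂ) (x : Fin n → ℂ) : ℝ :=
  (star x ⬝ᵥ A.mulVec x).re

/-- An indefinite Hermitian matrix: its quadratic form takes positive and negative values. -/
def IsIndefiniteHermitian {n : ℕ} (A : Matrix (Fin n) (Fin n) ℂ) : Prop :=
  A.IsHermitian ∧ (∃ v, 0 < hermForm A v) ∧ ∃ w, hermForm A w < 0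

/-- `ρ = ∑_{i=1}^n m_i`. -/
def mosRho (n : ℕ) (m : ℕ → ℕ) : ℕ := ∑ i ∈ Finset.Icc 1 n, m i

/-- `C = ∏_{i=1}^n (s_1 / s_i) ^ m_i`. -/
noncomputable def mosC (n : ℕ) (s : ℕ → ℝ) (m : ℕ → ℕ) : ℝ :=
  ∏ i ∈ Finset.Icc 1 n, (s 1 / s i) ^ m i

/-- `γ_k = ∑_{i=1}^n (m_i / k) (1 - s_1 / s_i) ^ k`, for `k ≥ 1`. -/
noncomputable def mosGamma (n : ℕ) (s : ℕ → ℝ) (m : ℕ → ℕ) (k : ℕ) : ℝ :=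
  ∑ i ∈ Finset.Icc 1 n, (m i : ℝ) / k * (1 - s 1 / s i) ^ k

/-- `δ_0 = 1` and `δ_{k+1} = (1 / (k+1)) ∑_{i=1}^{k+1} i γ_i δ_{k+1-i}` (here `i = j + 1`; the
recursion is restated in this form in `mosDelta_succ`). -/
noncomputable def mosDelta (n : ℕ) (s : ℕ → ℝ) (m : ℕ → ℕ) : ℕ → ℝ
  | 0 => 1
  | k + 1 => 1 / ((k : ℝ) + 1) *
      ∑ j : Fin (k + 1), ((j : ℝ) + 1) * mosGamma n s m (j + 1) * mosDelta n s m (k - j)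
  termination_by k => k
  decreasing_by omega

theorem mosDelta_zero (n : ℕ) (s : ℕ → ℝ) (m : ℕ → ℕ) : mosDelta n s m 0 = 1 := by
  rw [mosDelta]

theorem mosDelta_succ (n : ℕ) (s : ℕ → ℝ) (m : ℕ → ℕ) (k : ℕ) :
    mosDelta n s m (k + 1) = 1 / ((k : ℝ) + 1) *
      ∑ i ∈ Finset.Icc 1 (k + 1), (i : ℝ) * mosGamma n s m i * mosDelta n s m (k + 1 - i) := by
  rw [mosDelta, Fin.sum_univ_eq_sum_range
    (fun j => ((j : ℝ) + 1) * mosGamma n s m (j + 1) * mosDelta n s m (k - j)) (k + 1),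
    ← Finset.Ico_add_one_right_eq_Icc, Finset.sum_Ico_eq_sum_range]
  congr 1
  refine Finset.sum_congr (by simp) fun j _ => ?_
  rw [Nat.add_comm 1 j, Nat.add_sub_add_right]
  push_cast
  rfl

/-- `δ̄_k = C δ_k`. -/
noncomputable def mosDeltaBar (n : ℕ) (s : ℕ → ℝ) (m : ℕ → ℕ) (k : ℕ) : ℝ :=
  mosC n s m * mosDelta n s m k

/-! The law of the form is identified through its characteristic function. A unitary change of
variables diagonalizes `Ω` and preserves the Gaussian density, so the characteristic function is `∏
j, (1 - i t λ j)⁻¹` over the eigenvalues (`integral_cexp_hermForm_complexGaussian`). Zero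
eigenvalues contribute `1`; the positive and negative ones form two groups.

In each group put `w = (1 - i t s 1)⁻¹`. Then `1 - i t s i = (s i / s 1) w⁻¹ (1 - r i w)` with `r i
= 1 - s 1 / s i ∈ [0, 1)`, since `s 1` is the eigenvalue of the group nearest to `0`. The product
over the group is therefore `C w ^ ρ ∏ i, (1 - r i w) ^ (-m i)`. The `δ k` are the power series
coefficients of the last product, their recursion being its logarithmic derivative read
coefficientwise, so the group contributes `∑ k, δ̄ k w ^ (ρ + k)` (`mosDeltaBar_charFun`).

Powers of `w` are characteristic functions of Erlang laws with scale `|s 1|`, reflected for the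
negative group. The weights are nonnegative and summable, so the product of the two series is the
characteristic function of a genuine mixture of differences of independent Erlang variables, and
uniqueness gives `map_hermForm_complexGaussian_eq_erlangDiffMixture`. The tail of each difference is
a finite sum (`erlangDiff_real_Ioi`), and countable additivity of the mixture gives the double
series. -/

/-! ### Unitary diagonalization and the characteristic function of the form -/

theorem measurePreserving_mulVec_of_mem_unitary {n : ℕ} (U : Matrix.unitaryGroup (Fin n) ℂ) :
    MeasurePreserving (fun y : Fin n → ℂ => (U : Matrix (Fin n) (Fin n) ℂ).mulVec y) := by
  have hdet : ‖(U : Matrix (Fin n) (Fin n) ℂ).det‖ = 1 :=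
    CStarRing.norm_of_mem_unitary (Matrix.det_of_mem_unitary U.2)
  -- The determinant of a complex-linear map over `ℝ` is `|det|²`, here `1`.
  have hf : LinearMap.det ((Matrix.toLin' (U : Matrix (Fin n) (Fin n) ℂ)).restrictScalars ℝ) = 1 := by
    rw [LinearMap.det_restrictScalars, LinearMap.det_toLin', Algebra.norm_complex_apply,
      Complex.normSq_eq_norm_sq, hdet, one_pow]
  have h := Measure.map_linearMap_addHaar_eq_smul_addHaar
    (volume : Measure (Fin n → ℂ)) (f := (Matrix.toLin'
      (U : Matrix (Fin n) (Fin n) ℂ)).restrictScalars ℝ) (by rw [hf]; exact one_ne_zero)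
  rw [hf] at h
  refine ⟨(Continuous.matrix_mulVec continuous_const continuous_id).measurable, ?_⟩
  simp only [inv_one, abs_one, ENNReal.ofReal_one, one_smul] at h
  exact h

theorem hermForm_one {n : ℕ} (x : Fin n → ℂ) : hermForm 1 x = ∑ j, ‖x j‖ ^ 2 := by
  simp [hermForm, dotProduct, ← Complex.normSq_eq_conj_mul_self, Complex.normSq_eq_norm_sq]
  exact Finset.sum_congr rfl fun i _ => by rw [← Complex.ofReal_pow, Complex.ofReal_re]

theorem hermForm_mulVec {n : ℕ} (A B : Matrix (Fin n) (Fin n) ℂ) (y : Fin n → ℂ) :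
    hermForm A (B.mulVec y) = hermForm (star B * A * B) y := by
  rw [hermForm, hermForm, Matrix.star_mulVec, ← Matrix.dotProduct_mulVec, Matrix.mulVec_mulVec,
    Matrix.mulVec_mulVec, Matrix.star_eq_conjTranspose]

theorem hermForm_one_mulVec_unitary {n : ℕ} (U : Matrix.unitaryGroup (Fin n) ℂ) (y : Fin n → ℂ) :
    hermForm 1 ((U : Matrix (Fin n) (Fin n) ℂ).mulVec y) = ∑ j, ‖y j‖ ^ 2 := by
  rw [hermForm_mulVec, mul_one, Unitary.coe_star_mul_self, hermForm_one]

theorem hermForm_eigenvectorUnitary {n : ℕ} {A : Matrix (Fin n) (Fin n) ℂ} (hA : A.IsHermitian)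
    (y : Fin n → ℂ) :
    hermForm A ((hA.eigenvectorUnitary : Matrix (Fin n) (Fin n) ℂ).mulVec y) =
      ∑ j, hA.eigenvalues j * ‖y j‖ ^ 2 := by
  have h := hA.conjStarAlgAut_star_eigenvectorUnitary
  rw [Unitary.conjStarAlgAut_star_apply] at h
  rw [hermForm_mulVec, h, hermForm, dotProduct, Complex.re_sum]
  refine Finset.sum_congr rfl fun j _ => ?_
  rw [Matrix.mulVec_diagonal, Pi.star_apply, mul_left_comm, Complex.star_def,
    ← Complex.normSq_eq_conj_mul_self, Complex.normSq_eq_norm_sq]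
  exact (congrArg Complex.re (Complex.ofReal_mul _ _)).symm.trans (Complex.ofReal_re _)

/-- In eigencoordinates the form is `∑ λ j |y j|²`, which is `≤ 0` if no `λ j` is positive. -/
theorem exists_eigenvalues_pos {n : ℕ} {A : Matrix (Fin n) (Fin n) ℂ} (hA : A.IsHermitian)
    {v : Fin n → ℂ} (hv : 0 < hermForm A v) : ∃ j, 0 < hA.eigenvalues j := by
  by_contra! h
  have hU : v = (hA.eigenvectorUnitary : Matrix (Fin n) (Fin n) ℂ).mulVec
      ((star (hA.eigenvectorUnitary : Matrix (Fin n) (Fin n) ℂ)).mulVec v) := by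
    rw [Matrix.mulVec_mulVec, Unitary.mul_star_self_of_mem hA.eigenvectorUnitary.2, Matrix.one_mulVec]
  rw [hU, hermForm_eigenvectorUnitary] at hv
  exact hv.not_ge (Finset.sum_nonpos fun j _ => mul_nonpos_of_nonpos_of_nonneg (h j) (by positivity))

theorem exists_eigenvalues_neg {n : ℕ} {A : Matrix (Fin n) (Fin n) ℂ} (hA : A.IsHermitian)
    {v : Fin n → ℂ} (hv : hermForm A v < 0) : ∃ j, hA.eigenvalues j < 0 := by
  by_contra! h
  have hU : v = (hA.eigenvectorUnitary : Matrix (Fin n) (Fin n) ℂ).mulVec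
      ((star (hA.eigenvectorUnitary : Matrix (Fin n) (Fin n) ℂ)).mulVec v) := by
    rw [Matrix.mulVec_mulVec, Unitary.mul_star_self_of_mem hA.eigenvectorUnitary.2, Matrix.one_mulVec]
  rw [hU, hermForm_eigenvectorUnitary] at hv
  exact hv.not_ge (Finset.sum_nonneg fun j _ => mul_nonneg (h j) (by positivity))

theorem continuous_hermForm {n : ℕ} (A : Matrix (Fin n) (Fin n) ℂ) : Continuous (hermForm A) := by
  unfold hermForm
  fun_prop

theorem integral_complexGaussian {n : ℕ} (g : (Fin n → ℂ) → ℂ) :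
    ∫ x, g x ∂(complexGaussian 0 1) =
      ∫ x, ((Real.pi ^ n)⁻¹ * Real.exp (-hermForm 1 x) : ℝ) * g x := by
  have hd : ∀ x : Fin n → ℂ, 1 / (Real.pi ^ n * ‖(1 : Matrix (Fin n) (Fin n) ℂ).det‖) *
      Real.exp (-(star (x - 0) ⬝ᵥ ((1 : Matrix (Fin n) (Fin n) ℂ)⁻¹).mulVec (x - 0)).re) =
      (Real.pi ^ n)⁻¹ * Real.exp (-hermForm 1 x) := by
    intro x
    simp [hermForm]
  rw [complexGaussian]
  simp_rw [hd]
  rw [integral_withDensity_eq_integral_toReal_smul]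
  · refine integral_congr_ae (ae_of_all _ fun x => ?_)
    simp only
    rw [ENNReal.toReal_ofReal (by positivity), Complex.real_smul]
  · have := (continuous_hermForm (1 : Matrix (Fin n) (Fin n) ℂ)).measurable
    fun_prop
  · exact ae_of_all _ fun x => ENNReal.ofReal_lt_top

/-- The characteristic function of a Hermitian form in a standard complex Gaussian vector. -/
theorem integral_cexp_hermForm_complexGaussian {n : ℕ} {A : Matrix (Fin n) (Fin n) ℂ}
    (hA : A.IsHermitian) (t : ℝ) :
    ∫ x, Complex.exp (t * hermForm A x * Complex.I) ∂(complexGaussian 0 1) =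
      ∏ j, (1 - t * hA.eigenvalues j * Complex.I)⁻¹ := by
  have hb : ∀ c : ℝ, 0 < (1 - t * c * Complex.I : ℂ).re := fun c => by simp
  rw [integral_complexGaussian]
  have hmp := measurePreserving_mulVec_of_mem_unitary hA.eigenvectorUnitary
  have h1 := continuous_hermForm (1 : Matrix (Fin n) (Fin n) ℂ)
  have h2 := continuous_hermForm A
  rw [← hmp.map_eq, integral_map hmp.measurable.aemeasurable
    (Continuous.aestronglyMeasurable (by fun_prop))]
  have : ∀ y : Fin n → ℂ,
      (((Real.pi ^ n)⁻¹ * Real.exp (-hermForm 1 ((hA.eigenvectorUnitary :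
          Matrix (Fin n) (Fin n) ℂ).mulVec y)) : ℝ) : ℂ) *
        Complex.exp (t * hermForm A ((hA.eigenvectorUnitary :
          Matrix (Fin n) (Fin n) ℂ).mulVec y) * Complex.I) =
      ∏ j, (Real.pi : ℂ)⁻¹ *
        Complex.exp (-(1 - t * hA.eigenvalues j * Complex.I) * ‖y j‖ ^ 2) := by
    intro y
    rw [hermForm_one_mulVec_unitary, hermForm_eigenvectorUnitary, Finset.prod_mul_distrib,
      Finset.prod_const, Finset.card_univ, Fintype.card_fin, ← Complex.exp_sum]
    push_cast
    rw [mul_assoc, ← Complex.exp_add, inv_pow]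
    congr 2
    rw [Finset.mul_sum, Finset.sum_mul, ← Finset.sum_neg_distrib, ← Finset.sum_add_distrib]
    exact Finset.sum_congr rfl fun j _ => by ring
  simp_rw [this]
  rw [integral_fintype_prod_volume_eq_prod (fun j (z : ℂ) => (Real.pi : ℂ)⁻¹ *
    Complex.exp (-(1 - t * hA.eigenvalues j * Complex.I) * ‖z‖ ^ 2))]
  refine Finset.prod_congr rfl fun j _ => ?_
  rw [integral_const_mul, GaussianFourier.integral_cexp_neg_mul_sq_norm (hb _),
    Complex.finrank_real_complex]
  have hpi : (Real.pi : ℂ) ≠ 0 := by exact_mod_cast Real.pi_ne_zero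
  norm_num
  field_simp

/-! ### Power series with a known logarithmic derivative -/

open PowerSeries in
/-- `E` has logarithmic derivative `G` (that is `X E' = G E`), constant coefficient `1`, and sums
absolutely to `v` at `w`. -/
structure HasLogDerivSum (w : ℂ) (E G : PowerSeries ℝ) (v : ℂ) : Prop where
  logDeriv : X * derivative ℝ E = G * E
  constantCoeff : constantCoeff E = 1
  summable : Summable fun k => ‖((coeff k E : ℝ) : ℂ) * w ^ k‖
  tsum_eq : ∑' k, ((coeff k E : ℝ) : ℂ) * w ^ k = v

namespace HasLogDerivSum
open PowerSeries

theorem one (w : ℂ) : HasLogDerivSum w 1 0 1 where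
  logDeriv := by simp
  constantCoeff := by simp
  summable := by
    refine summable_of_ne_finset_zero (s := {0}) fun k hk => ?_
    simp [coeff_one, (by simpa using hk : k ≠ 0)]
  tsum_eq := by
    rw [tsum_eq_single 0 fun k hk => by simp [coeff_one, hk]]
    simp

/-- Logarithmic derivatives add under products, and the Cauchy product of absolutely convergent
series converges absolutely to the product of the sums. -/
theorem mul {w : ℂ} {E F G H : PowerSeries ℝ} {u v : ℂ} (hE : HasLogDerivSum w E G u)
    (hF : HasLogDerivSum w F H v) : HasLogDerivSum w (E * F) (G + H) (u * v) := by
  have key : ∀ k, ((coeff k (E * F) : ℝ) : ℂ) * w ^ k =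
      ∑ p ∈ Finset.HasAntidiagonal.antidiagonal k, (((coeff p.1 E : ℝ) : ℂ) * w ^ p.1) * 
        (((coeff p.2 F : ℝ) : ℂ) * w ^ p.2) := by
    intro k
    rw [coeff_mul, Complex.ofReal_sum, Finset.sum_mul]
    refine Finset.sum_congr rfl fun p hp => ?_
    rw [← Finset.HasAntidiagonal.mem_antidiagonal.1 hp, pow_add]
    push_cast
    ring
  refine ⟨?_, by simp [hE.constantCoeff, hF.constantCoeff], ?_, ?_⟩
  · rw [Derivation.leibniz, smul_eq_mul, smul_eq_mul]
    linear_combination F * hE.logDeriv + E * hF.logDeriv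
  · simp_rw [key]
    have := summable_norm_sum_mul_antidiagonal_of_summable_norm hE.summable hF.summable
    exact this
  · simp_rw [key]
    rw [← tsum_mul_tsum_eq_tsum_sum_antidiagonal_of_summable_norm hE.summable hF.summable,
      hE.tsum_eq, hF.tsum_eq]

theorem pow {w : ℂ} {E G : PowerSeries ℝ} {u : ℂ} (hE : HasLogDerivSum w E G u) (m : ℕ) :
    HasLogDerivSum w (E ^ m) (m • G) (u ^ m) := by
  induction m with
  | zero => simpa using one w
  | succ m ih => simpa only [pow_succ, succ_nsmul] using ih.mul hE

theorem prod {ι : Type*} {w : ℂ} (s : Finset ι) {E G : ι → PowerSeries ℝ} {u : ι → ℂ}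
    (h : ∀ i ∈ s, HasLogDerivSum w (E i) (G i) (u i)) :
    HasLogDerivSum w (∏ i ∈ s, E i) (∑ i ∈ s, G i) (∏ i ∈ s, u i) := by
  classical
  induction s using Finset.induction_on with
  | empty => simpa using one w
  | insert a s ha ih =>
    rw [Finset.prod_insert ha, Finset.sum_insert ha, Finset.prod_insert ha]
    exact (h a (by simp)).mul (ih fun i hi => h i (by simp [hi]))

theorem coeff_succ {w v : ℂ} {E G : PowerSeries ℝ} (h : HasLogDerivSum w E G v) (k : ℕ) :
    ((k : ℝ) + 1) * coeff (k + 1) E =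
      ∑ i ∈ Finset.range (k + 2), coeff i G * coeff (k + 1 - i) E := by
  have := congrArg (coeff (k + 1)) h.logDeriv
  rw [coeff_succ_X_mul, coeff_derivative, coeff_mul,
    Finset.Nat.sum_antidiagonal_eq_sum_range_succ (fun i j => coeff i G * coeff j E)] at this
  rw [← this, mul_comm]

/-- For `E = 1 / (1 - r X)`, `X E' / E = r X / (1 - r X)`. As `r < 1`, convergence holds on the
closed unit disc, where all the points `(1 - i c)⁻¹` lie. -/
theorem geometric {r : ℝ} (hr0 : 0 ≤ r) (hr : r < 1) {w : ℂ} (hw : ‖w‖ ≤ 1) :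
    HasLogDerivSum w (PowerSeries.mk fun k => r ^ k) (PowerSeries.mk fun k => if k = 0 then 0 else r ^ k)
      (1 - r * w)⁻¹ := by
  have hlt : ‖(r : ℂ) * w‖ < 1 := by
    rw [norm_mul, Complex.norm_real, Real.norm_of_nonneg hr0]
    nlinarith [norm_nonneg w]
  have hc : ∀ k, ((coeff k (PowerSeries.mk fun k => r ^ k) : ℝ) : ℂ) * w ^ k = (r * w) ^ k := by
    intro k
    rw [coeff_mk, mul_pow]
    push_cast
    rfl
  refine ⟨?_, by rw [← coeff_zero_eq_constantCoeff_apply, coeff_mk, pow_zero], ?_, ?_⟩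
  · ext k
    rcases k with _ | k
    · rw [coeff_zero_X_mul, coeff_mul]
      simp [-coeff_zero_eq_constantCoeff]
    · rw [coeff_succ_X_mul, coeff_derivative, coeff_mul,
        Finset.Nat.sum_antidiagonal_eq_sum_range_succ
          (fun i j => coeff i (PowerSeries.mk fun k => if k = 0 then 0 else r ^ k) * coeff j (PowerSeries.mk fun k => r ^ k)),
        Finset.sum_range_succ']
      have : ∀ i ∈ Finset.range (k + 1), r ^ (i + 1) * r ^ (k + 1 - (i + 1)) = r ^ (k + 1) := by
        intro i hi
        rw [← pow_add]
        congr 1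
        have := Finset.mem_range.1 hi
        omega
      simp only [coeff_mk, Nat.add_eq_zero_iff, one_ne_zero, and_false, if_false, if_true, zero_mul,
        add_zero, Finset.sum_congr rfl this, Finset.sum_const, Finset.card_range, nsmul_eq_mul]
      push_cast
      ring
  · simp_rw [hc, norm_pow]
    exact summable_geometric_of_lt_one (norm_nonneg _) hlt
  · simp_rw [hc]
    exact tsum_geometric_of_norm_lt_one hlt

end HasLogDerivSum

/-! ### The coefficients `δ` and the expansion of one group of factors -/

theorem mosGamma_nonneg {n : ℕ} {s : ℕ → ℝ} {m : ℕ → ℕ}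
    (hs : ∀ i ∈ Finset.Icc 1 n, 0 ≤ 1 - s 1 / s i) (k : ℕ) : 0 ≤ mosGamma n s m k :=
  Finset.sum_nonneg fun i hi => mul_nonneg (by positivity) (pow_nonneg (hs i hi) _)

/-- Nonnegativity is what lets the `δ` serve as mixture weights. -/
theorem mosDelta_nonneg {n : ℕ} {s : ℕ → ℝ} {m : ℕ → ℕ}
    (hs : ∀ i ∈ Finset.Icc 1 n, 0 ≤ 1 - s 1 / s i) (k : ℕ) : 0 ≤ mosDelta n s m k := by
  induction k using Nat.strong_induction_on with
  | _ k ih =>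
    rcases k with _ | k
    · simp [mosDelta_zero]
    · rw [mosDelta_succ]
      refine mul_nonneg (by positivity) (Finset.sum_nonneg fun i hi => ?_)
      have := Finset.mem_Icc.1 hi
      exact mul_nonneg (mul_nonneg (by positivity) (mosGamma_nonneg hs i)) (ih _ (by omega))

theorem mosC_pos {n : ℕ} {s : ℕ → ℝ} {m : ℕ → ℕ} (hs : ∀ i ∈ Finset.Icc 1 n, 0 < s 1 / s i) :
    0 < mosC n s m :=
  Finset.prod_pos fun i hi => pow_pos (hs i hi) _

theorem mosDeltaBar_nonneg {n : ℕ} {s : ℕ → ℝ} {m : ℕ → ℕ}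
    (hs : ∀ i ∈ Finset.Icc 1 n, 0 < s 1 / s i ∧ s 1 / s i ≤ 1) (k : ℕ) :
    0 ≤ mosDeltaBar n s m k :=
  mul_nonneg (mosC_pos fun i hi => (hs i hi).1).le
    (mosDelta_nonneg (fun i hi => sub_nonneg.2 (hs i hi).2) k)

open PowerSeries in
/-- The generating function of `δ` is `∏ i, (1 - r i w) ^ (-m i)` with `r i = 1 - s 1 / s i`. -/
theorem mosDelta_generating {n : ℕ} {s : ℕ → ℝ} {m : ℕ → ℕ}
    (hs : ∀ i ∈ Finset.Icc 1 n, 0 < s 1 / s i ∧ s 1 / s i ≤ 1) {w : ℂ} (hw : ‖w‖ ≤ 1) :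
    (Summable fun k => ‖(mosDelta n s m k : ℂ) * w ^ k‖) ∧
      ∑' k, (mosDelta n s m k : ℂ) * w ^ k =
        ∏ i ∈ Finset.Icc 1 n, (1 - ((1 - s 1 / s i : ℝ) : ℂ) * w)⁻¹ ^ m i := by
  have H := HasLogDerivSum.prod (Finset.Icc 1 n) fun i hi =>
    (HasLogDerivSum.geometric (sub_nonneg.2 (hs i hi).2) (sub_lt_self 1 (hs i hi).1) hw).pow (m i)
  set E := ∏ i ∈ Finset.Icc 1 n, (PowerSeries.mk fun k => (1 - s 1 / s i) ^ k) ^ m i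
  set G := ∑ i ∈ Finset.Icc 1 n, m i • (PowerSeries.mk fun k => if k = 0 then 0 else (1 - s 1 / s i) ^ k)
    with hG
  have hG0 : coeff 0 G = 0 := by
    simp only [hG, map_sum, map_nsmul, coeff_mk, if_true, smul_zero, Finset.sum_const_zero]
  have hGk : ∀ k, 1 ≤ k → coeff k G = k * mosGamma n s m k := by
    intro k hk
    have hk0 : k ≠ 0 := by omega
    rw [hG, map_sum, mosGamma, Finset.mul_sum]
    refine Finset.sum_congr rfl fun i _ => ?_
    have : (k : ℝ) ≠ 0 := by exact_mod_cast hk0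
    rw [map_nsmul, coeff_mk, if_neg hk0, nsmul_eq_mul]
    field_simp
  -- Since `k γ k` is the `k`-th coefficient of `G`, comparing coefficients in `X E' = G E` gives
  -- the recursion of `δ`.
  have hE : ∀ k, coeff k E = mosDelta n s m k := by
    intro k
    induction k using Nat.strong_induction_on with
    | _ k ih =>
      rcases k with _ | k
      · rw [mosDelta_zero, coeff_zero_eq_constantCoeff_apply, H.constantCoeff]
      · have h1 := H.coeff_succ k
        rw [Finset.range_eq_Ico, Finset.sum_eq_sum_Ico_succ_bot (by omega), hG0, zero_mul, zero_add,
          zero_add, show k + 2 = (k + 1) + 1 from rfl, Finset.Ico_add_one_right_eq_Icc] at h1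
        rw [mosDelta_succ, one_div_mul_eq_div, eq_div_iff (by positivity), mul_comm, h1]
        refine Finset.sum_congr rfl fun i hi => ?_
        have := Finset.mem_Icc.1 hi
        rw [hGk i this.1, ih _ (by omega)]
  simp_rw [← hE]
  exact ⟨H.summable, H.tsum_eq⟩

theorem one_sub_ofReal_mul_I_ne_zero (c : ℝ) : (1 - c * Complex.I : ℂ) ≠ 0 := fun h => by
  simpa using congrArg Complex.re h

theorem norm_inv_one_sub_ofReal_mul_I_le (c : ℝ) : ‖(1 - c * Complex.I : ℂ)⁻¹‖ ≤ 1 := by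
  rw [norm_inv]
  refine inv_le_one_of_one_le₀ ?_
  have := Complex.re_le_norm (1 - c * Complex.I : ℂ)
  simpa using this

/-- The characteristic function of the Moschopoulos mixture of gamma laws. -/
theorem mosDeltaBar_charFun {n : ℕ} {s : ℕ → ℝ} {m : ℕ → ℕ}
    (hs : ∀ i ∈ Finset.Icc 1 n, 0 < s 1 / s i ∧ s 1 / s i ≤ 1) (t : ℝ) :
    (Summable fun k => ‖(mosDeltaBar n s m k : ℂ) *
        (1 - (t * s 1 : ℝ) * Complex.I : ℂ)⁻¹ ^ (mosRho n m + k)‖) ∧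
      ∑' k, (mosDeltaBar n s m k : ℂ) *
        (1 - (t * s 1 : ℝ) * Complex.I : ℂ)⁻¹ ^ (mosRho n m + k) =
        ∏ i ∈ Finset.Icc 1 n, (1 - (t * s i : ℝ) * Complex.I : ℂ)⁻¹ ^ m i := by
  set w : ℂ := (1 - (t * s 1 : ℝ) * Complex.I : ℂ)⁻¹ with hw
  have hw0 : w ≠ 0 := inv_ne_zero (one_sub_ofReal_mul_I_ne_zero _)
  obtain ⟨h1, h2⟩ := mosDelta_generating (m := m) hs
    (norm_inv_one_sub_ofReal_mul_I_le (t * s 1))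
  rw [← hw] at h1 h2
  have key : ∀ k, (mosDeltaBar n s m k : ℂ) * w ^ (mosRho n m + k) =
      (mosC n s m * w ^ mosRho n m) * (mosDelta n s m k * w ^ k) := by
    intro k
    rw [mosDeltaBar, pow_add]
    push_cast
    ring
  simp_rw [key]
  constructor
  · simp_rw [norm_mul] at h1 ⊢
    exact h1.mul_left _
  · rw [tsum_mul_left, h2, mosC, mosRho, ← Finset.prod_pow_eq_pow_sum, Complex.ofReal_prod,
      ← Finset.prod_mul_distrib, ← Finset.prod_mul_distrib]
    refine Finset.prod_congr rfl fun i hi => ?_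
    have hdiv := (hs i hi).1.ne'
    have hsi : s i ≠ 0 := fun h => hdiv (by rw [h, div_zero])
    have hs1 : s 1 ≠ 0 := fun h => hdiv (by rw [h, zero_div])
    rw [Complex.ofReal_pow, ← mul_pow, ← mul_pow]
    congr 1
    have hsi' : (s i : ℂ) ≠ 0 := by exact_mod_cast hsi
    have hs1' : (s 1 : ℂ) ≠ 0 := by exact_mod_cast hs1
    -- This identity turns every factor of the group into a function of the single variable `w`.
    have h3 : (1 - (t * s i : ℝ) * Complex.I : ℂ) =
        (s i / s 1) * w⁻¹ * (1 - ((1 - s 1 / s i : ℝ) : ℂ) * w) := by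
      rw [mul_assoc, mul_sub, mul_one, mul_left_comm, inv_mul_cancel₀ hw0, mul_one, hw, inv_inv]
      push_cast
      field_simp
      ring
    rw [h3, mul_inv, mul_inv, inv_inv]
    push_cast
    rw [inv_div]

/-! ### Erlang laws and differences of independent Erlang variables -/

section Erlang

open Set Filter Topology

theorem integrableOn_pow_mul_exp_neg_mul (n : ℕ) {b : ℝ} (hb : 0 < b) :
    IntegrableOn (fun x : ℝ => x ^ n * Real.exp (-b * x)) (Ioi 0) := by
  have h := integrableOn_rpow_mul_exp_neg_mul_rpow (p := 1) (s := n) (b := b)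
    (by linarith [n.cast_nonneg (α := ℝ)]) one_pos hb
  simpa using h

theorem norm_pow_mul_cexp_neg_mul (n : ℕ) (z : ℂ) {x : ℝ} (hx : 0 ≤ x) :
    ‖(x : ℂ) ^ n * Complex.exp (-z * x)‖ = x ^ n * Real.exp (-z.re * x) := by
  rw [norm_mul, norm_pow, Complex.norm_real, Real.norm_of_nonneg hx, Complex.norm_exp]
  simp

theorem integrableOn_pow_mul_cexp_neg_mul (n : ℕ) {z : ℂ} (hz : 0 < z.re) :
    IntegrableOn (fun x : ℝ => (x : ℂ) ^ n * Complex.exp (-z * x)) (Ioi 0) := by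
  refine (integrableOn_pow_mul_exp_neg_mul n hz).mono'
    (Continuous.aestronglyMeasurable (by fun_prop)) ?_
  refine (ae_restrict_iff' measurableSet_Ioi).2 (ae_of_all _ fun x hx => ?_)
  exact (norm_pow_mul_cexp_neg_mul n z (le_of_lt hx)).le

/-- Induction by parts: `x ^ (n + 1) e ^ (-z x)` vanishes at `0` and at infinity, so its derivative
integrates to `0`. -/
theorem integral_pow_mul_cexp_neg_mul_Ioi (n : ℕ) {z : ℂ} (hz : 0 < z.re) :
    ∫ x in Ioi (0 : ℝ), (x : ℂ) ^ n * Complex.exp (-z * x) = n.factorial / z ^ (n + 1) := by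
  have hz0 : z ≠ 0 := fun h => by simp [h] at hz
  induction n with
  | zero =>
    have := integral_exp_mul_complex_Ioi (a := -z) (by simpa using hz) 0
    simpa [neg_div_neg_eq] using this
  | succ n ih =>
    have hderiv : ∀ x ∈ Ici (0 : ℝ), HasDerivAt
        (fun x : ℝ => (x : ℂ) ^ (n + 1) * Complex.exp (-z * x))
        ((n + 1) * ((x : ℂ) ^ n * Complex.exp (-z * x)) -
          z * ((x : ℂ) ^ (n + 1) * Complex.exp (-z * x))) x := by
      intro x _
      have h1 : HasDerivAt (fun w : ℂ => w ^ (n + 1)) (((n + 1 : ℕ) : ℂ) * (x : ℂ) ^ n) (x : ℂ) := by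
        simpa using hasDerivAt_pow (n + 1) (x : ℂ)
      have h2 : HasDerivAt (fun w : ℂ => Complex.exp (-z * w)) (Complex.exp (-z * x) * (-z)) (x : ℂ) := by
        simpa using ((hasDerivAt_id (x : ℂ)).const_mul (-z)).cexp
      convert! (h1.mul h2).comp_ofReal using 1
      push_cast
      ring
    have hint := ((integrableOn_pow_mul_cexp_neg_mul n hz).const_mul ((n : ℂ) + 1)).sub
      ((integrableOn_pow_mul_cexp_neg_mul (n + 1) hz).const_mul z)
    have htends : Tendsto (fun x : ℝ => (x : ℂ) ^ (n + 1) * Complex.exp (-z * x)) atTop (𝓝 0) := by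
      rw [tendsto_zero_iff_norm_tendsto_zero]
      have h := ((Real.tendsto_pow_mul_exp_neg_atTop_nhds_zero (n + 1)).comp
        (tendsto_id.const_mul_atTop hz)).const_mul (z.re ^ (n + 1))⁻¹
      rw [mul_zero] at h
      refine h.congr' ?_
      filter_upwards [eventually_ge_atTop 0] with x hx
      rw [norm_pow_mul_cexp_neg_mul _ _ hx, Function.comp_apply, id, mul_pow, ← mul_assoc,
        ← mul_assoc, inv_mul_cancel₀ (pow_ne_zero _ hz.ne'), one_mul, neg_mul]
    have h := integral_Ioi_of_hasDerivAt_of_tendsto' hderiv hint htends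
    rw [integral_sub ((integrableOn_pow_mul_cexp_neg_mul n hz).const_mul _)
      ((integrableOn_pow_mul_cexp_neg_mul (n + 1) hz).const_mul _), integral_const_mul,
      integral_const_mul, ih] at h
    simp only [Complex.ofReal_zero, ne_eq, Nat.add_eq_zero_iff, one_ne_zero, and_false,
      not_false_eq_true, zero_pow, zero_mul, sub_zero] at h
    rw [Nat.factorial_succ, eq_div_iff (by positivity)]
    have h' := sub_eq_zero.1 h
    generalize (∫ x in Ioi (0 : ℝ), (x : ℂ) ^ (n + 1) * Complex.exp (-z * x)) = J at h' ⊢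
    rw [← mul_right_inj' (pow_ne_zero (n + 1) hz0)] at h'
    field_simp at h'
    push_cast
    linear_combination -h'

theorem integral_pow_mul_exp_neg_mul_Ioi (n : ℕ) {b : ℝ} (hb : 0 < b) :
    ∫ x in Ioi (0 : ℝ), x ^ n * Real.exp (-b * x) = n.factorial / b ^ (n + 1) := by
  have h := integral_pow_mul_cexp_neg_mul_Ioi n (z := b) (by simpa using hb)
  rw [← Complex.ofReal_inj, ← integral_complex_ofReal]
  push_cast
  exact h

/-- The Erlang law with shape `n + 1` and rate `r`. -/
noncomputable def erlangMeasure (n : ℕ) (r : ℝ) : Measure ℝ :=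
  (volume.restrict (Ioi 0)).withDensity fun x =>
    ENNReal.ofReal (r ^ (n + 1) / n.factorial * (x ^ n * Real.exp (-r * x)))

theorem integral_erlangMeasure {E : Type*} [NormedAddCommGroup E] [NormedSpace ℝ E] (n : ℕ) {r : ℝ}
    (hr : 0 < r) (g : ℝ → E) :
    ∫ x, g x ∂(erlangMeasure n r) =
      ∫ x in Ioi 0, (r ^ (n + 1) / n.factorial * (x ^ n * Real.exp (-r * x))) • g x := by
  rw [erlangMeasure, integral_withDensity_eq_integral_toReal_smul (by fun_prop)
    (ae_of_all _ fun x => ENNReal.ofReal_lt_top)]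
  refine setIntegral_congr_fun measurableSet_Ioi fun x hx => ?_
  have hx' : 0 < x := hx
  rw [ENNReal.toReal_ofReal (by positivity)]

theorem erlangMeasure_Ioi (n : ℕ) {r u : ℝ} (hr : 0 < r) (hu : 0 ≤ u) :
    erlangMeasure n r (Ioi u) = ENNReal.ofReal
      (∑ i ∈ Finset.range (n + 1), Real.exp (-(r * u)) * (r * u) ^ i / i.factorial) := by
  -- The truncated exponential series differentiates to itself minus its top term. Multiplied by `e
  -- ^ (-x)`, only that top term survives, which gives the antiderivative of the Erlang density.
  have hF : ∀ (n : ℕ) (x : ℝ), HasDerivAt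
      (fun x : ℝ => ∑ i ∈ Finset.range (n + 1), x ^ i / i.factorial)
      ((∑ i ∈ Finset.range (n + 1), x ^ i / i.factorial) - x ^ n / n.factorial) x := by
    intro n x
    induction n with
    | zero => simpa using hasDerivAt_const x (1 : ℝ)
    | succ n ih =>
      simp_rw [Finset.sum_range_succ _ (n + 1)]
      convert! ih.add ((hasDerivAt_pow (n + 1) x).div_const ((n + 1).factorial : ℝ)) using 1
      rw [Nat.factorial_succ]
      have : (n.factorial : ℝ) ≠ 0 := by positivity
      push_cast
      field_simp
      ring
  have hderiv : ∀ x ∈ Ici u, HasDerivAt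
      (fun x : ℝ => -(Real.exp (-(r * x)) * ∑ i ∈ Finset.range (n + 1), (r * x) ^ i / i.factorial))
      (r ^ (n + 1) / n.factorial * (x ^ n * Real.exp (-r * x))) x := by
    intro x _
    have h0 : HasDerivAt (fun x : ℝ => r * x) r x := by simpa using (hasDerivAt_id x).const_mul r
    convert! (h0.neg.exp.mul ((hF n (r * x)).comp x h0)).neg using 1
    simp only [Pi.neg_apply, Function.comp_apply]
    rw [mul_pow, neg_mul]
    ring
  have htends : Tendsto
      (fun x : ℝ => -(Real.exp (-(r * x)) * ∑ i ∈ Finset.range (n + 1), (r * x) ^ i / i.factorial))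
      atTop (𝓝 0) := by
    have hG : Tendsto
        (fun x : ℝ => -(Real.exp (-x) * ∑ i ∈ Finset.range (n + 1), x ^ i / i.factorial))
        atTop (𝓝 0) := by
      simp_rw [Finset.mul_sum]
      rw [← neg_zero, ← Finset.sum_const_zero (s := Finset.range (n + 1))]
      refine (tendsto_finsetSum _ fun i _ => ?_).neg
      have := (Real.tendsto_pow_mul_exp_neg_atTop_nhds_zero i).div_const (i.factorial : ℝ)
      rw [zero_div] at this
      refine this.congr fun x => ?_
      ring
    exact hG.comp (tendsto_id.const_mul_atTop hr)
  have hnn : ∀ x ∈ Ioi u, 0 ≤ r ^ (n + 1) / n.factorial * (x ^ n * Real.exp (-r * x)) := by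
    intro x hx
    have : 0 ≤ x := hu.trans (le_of_lt hx)
    positivity
  have hint := integrableOn_Ioi_deriv_of_nonneg' hderiv hnn htends
  have hval := integral_Ioi_of_hasDerivAt_of_tendsto' hderiv hint htends
  rw [erlangMeasure, withDensity_apply _ measurableSet_Ioi, Measure.restrict_restrict
    measurableSet_Ioi, Set.inter_eq_left.2 (Ioi_subset_Ioi hu),
    ← ofReal_integral_eq_lintegral_ofReal hint ((ae_restrict_iff' measurableSet_Ioi).2
      (ae_of_all _ hnn)), hval]
  congr 1
  rw [zero_sub, neg_neg, Finset.mul_sum]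
  simp_rw [mul_div_assoc]

/-- The law lives on `(0, ∞)`, so the tail formula at `u = 0`, where only `i = 0` survives, gives
the total mass. -/
theorem isProbabilityMeasure_erlangMeasure (n : ℕ) {r : ℝ} (hr : 0 < r) :
    IsProbabilityMeasure (erlangMeasure n r) := by
  have h := erlangMeasure_Ioi n hr le_rfl
  rw [Finset.sum_range_succ'] at h
  simp only [mul_zero, neg_zero, Real.exp_zero, ne_eq, Nat.add_eq_zero_iff, one_ne_zero, and_false,
    not_false_eq_true, zero_pow, zero_div, Finset.sum_const_zero, pow_zero,
    Nat.factorial_zero, Nat.cast_one, div_one, zero_add, mul_one, ENNReal.ofReal_one] at h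
  refine ⟨?_⟩
  rw [← h, erlangMeasure, withDensity_apply _ MeasurableSet.univ,
    withDensity_apply _ measurableSet_Ioi, Measure.restrict_univ,
    Measure.restrict_restrict measurableSet_Ioi, Set.inter_self]

theorem charFun_erlangMeasure (n : ℕ) {r : ℝ} (hr : 0 < r) (t : ℝ) :
    charFun (erlangMeasure n r) t = (1 - (t * r⁻¹ : ℝ) * Complex.I : ℂ)⁻¹ ^ (n + 1) := by
  rw [charFun_apply_real, integral_erlangMeasure n hr]
  have h : ∀ x : ℝ, (r ^ (n + 1) / n.factorial * (x ^ n * Real.exp (-r * x))) •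
      Complex.exp (t * x * Complex.I) =
      (r ^ (n + 1) / n.factorial : ℂ) *
        ((x : ℂ) ^ n * Complex.exp (-(r - t * Complex.I) * x)) := by
    intro x
    rw [Complex.real_smul]
    push_cast
    rw [mul_assoc, mul_assoc, ← Complex.exp_add]
    ring_nf
  simp_rw [h]
  rw [integral_const_mul, integral_pow_mul_cexp_neg_mul_Ioi n (by simpa using hr)]
  have hr' : (r : ℂ) ≠ 0 := by exact_mod_cast hr.ne'
  have hn : (n.factorial : ℂ) ≠ 0 := by exact_mod_cast n.factorial_ne_zero
  have h1 : (1 - (t * r⁻¹ : ℝ) * Complex.I : ℂ) = (r - t * Complex.I) / r := by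
    push_cast
    field_simp
  rw [h1, inv_div, div_pow]
  field_simp

/-- The law of the difference of two independent Erlang variables. -/
noncomputable def erlangDiff (n : ℕ) (r : ℝ) (n' : ℕ) (r' : ℝ) : Measure ℝ :=
  ((erlangMeasure n r).prod (erlangMeasure n' r')).map fun p => p.1 - p.2

theorem isProbabilityMeasure_erlangDiff (n n' : ℕ) {r r' : ℝ} (hr : 0 < r) (hr' : 0 < r') :
    IsProbabilityMeasure (erlangDiff n r n' r') := by
  have := isProbabilityMeasure_erlangMeasure n hr
  have := isProbabilityMeasure_erlangMeasure n' hr'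
  exact Measure.isProbabilityMeasure_map (by fun_prop)

theorem charFun_erlangDiff (n n' : ℕ) {r r' : ℝ} (hr : 0 < r) (hr' : 0 < r') (t : ℝ) :
    charFun (erlangDiff n r n' r') t =
      (1 - (t * r⁻¹ : ℝ) * Complex.I : ℂ)⁻¹ ^ (n + 1) *
        (1 - (t * -r'⁻¹ : ℝ) * Complex.I : ℂ)⁻¹ ^ (n' + 1) := by
  have := isProbabilityMeasure_erlangMeasure n hr
  have := isProbabilityMeasure_erlangMeasure n' hr'
  -- The subtracted variable enters through its characteristic function at `-t`.
  have h2 := charFun_erlangMeasure n' hr' (-t)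
  rw [neg_mul, ← mul_neg] at h2
  rw [← charFun_erlangMeasure n hr, ← h2, charFun_apply_real, charFun_apply_real,
    charFun_apply_real, erlangDiff, integral_map (by fun_prop)
      (Continuous.aestronglyMeasurable (by fun_prop)), ← integral_prod_mul]
  refine integral_congr_ae (ae_of_all _ fun p => ?_)
  simp only
  rw [← Complex.exp_add]
  push_cast
  ring_nf

/-- Condition on the second variable `y`: the first must exceed `t + y ≥ 0`, which has the finite
tail formula. Expanding `(t + y) ^ i` binomially leaves gamma integrals with rate `r + r'`. -/
theorem erlangDiff_real_Ioi (n n' : ℕ) {r r' t : ℝ} (hr : 0 < r) (hr' : 0 < r') (ht : 0 ≤ t) :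
    (erlangDiff n r n' r').real (Ioi t) =
      ∑ i ∈ Finset.range (n + 1), ∑ l ∈ Finset.range (i + 1),
        Real.exp (-(r * t)) * r ^ i / i.factorial * (i.choose l * t ^ (i - l)) *
          (r' ^ (n' + 1) / n'.factorial * ((n' + l).factorial / (r + r') ^ (n' + l + 1))) := by
  have := isProbabilityMeasure_erlangMeasure n hr
  have := isProbabilityMeasure_erlangMeasure n' hr'
  have hmeas : MeasurableSet {p : ℝ × ℝ | t < p.1 - p.2} :=
    measurableSet_lt measurable_const (by fun_prop)
  have hslice : ∀ y : ℝ, (fun x : ℝ => (x, y)) ⁻¹' {p : ℝ × ℝ | t < p.1 - p.2} = Ioi (t + y) := by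
    intro y
    ext x
    simp [lt_sub_iff_add_lt]
  have hfirst : (erlangDiff n r n' r').real (Ioi t) =
      ∫ y, (erlangMeasure n r (Ioi (t + y))).toReal ∂(erlangMeasure n' r') := by
    rw [integral_toReal]
    · rw [measureReal_def, erlangDiff, Measure.map_apply (by fun_prop) measurableSet_Ioi]
      change (((erlangMeasure n r).prod (erlangMeasure n' r')) {p : ℝ × ℝ | t < p.1 - p.2}).toReal = _
      rw [Measure.prod_apply_symm hmeas]
      simp_rw [hslice]
    · have := measurable_measure_prodMk_right (μ := erlangMeasure n r) hmeas
      simp_rw [hslice] at this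
      exact this.aemeasurable
    · exact ae_of_all _ fun y => measure_lt_top _ _
  rw [hfirst, integral_erlangMeasure n' hr']
  have hterm : ∀ y ∈ Ioi (0 : ℝ),
      (r' ^ (n' + 1) / n'.factorial * (y ^ n' * Real.exp (-r' * y))) •
        (erlangMeasure n r (Ioi (t + y))).toReal =
      ∑ i ∈ Finset.range (n + 1), ∑ l ∈ Finset.range (i + 1),
        Real.exp (-(r * t)) * r ^ i / i.factorial * (i.choose l * t ^ (i - l)) *
          (r' ^ (n' + 1) / n'.factorial) * (y ^ (n' + l) * Real.exp (-(r + r') * y)) := by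
    intro y hy
    have hy' : 0 < y := hy
    rw [erlangMeasure_Ioi n hr (by positivity), ENNReal.toReal_ofReal (by positivity), smul_eq_mul,
      Finset.mul_sum]
    refine Finset.sum_congr rfl fun i _ => ?_
    rw [mul_pow, add_comm t y, add_pow, Finset.mul_sum, Finset.mul_sum, Finset.sum_div,
      Finset.mul_sum]
    refine Finset.sum_congr rfl fun l _ => ?_
    have e1 : Real.exp (-(r * (y + t))) = Real.exp (-(r * t)) * Real.exp (-(r * y)) := by
      rw [← Real.exp_add]
      ring_nf
    have e2 : Real.exp (-(r + r') * y) = Real.exp (-r' * y) * Real.exp (-(r * y)) := by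
      rw [← Real.exp_add]
      ring_nf
    rw [e1, e2, pow_add]
    ring
  rw [setIntegral_congr_fun measurableSet_Ioi hterm]
  have hint := fun l => integrableOn_pow_mul_exp_neg_mul (n' + l) (add_pos hr hr')
  rw [integral_finsetSum _ fun i _ => integrable_finsetSum _ fun l _ => (hint l).const_mul _]
  refine Finset.sum_congr rfl fun i _ => ?_
  rw [integral_finsetSum _ fun l _ => (hint l).const_mul _]
  refine Finset.sum_congr rfl fun l _ => ?_
  rw [integral_const_mul, integral_pow_mul_exp_neg_mul_Ioi _ (add_pos hr hr'), mul_assoc]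

end Erlang

/-! ### Eigenvalues counted with multiplicity -/

theorem rootMultiplicity_charpoly_eq_card_eigenvalues {n : ℕ} {A : Matrix (Fin n) (Fin n) ℂ}
    (hA : A.IsHermitian) (r : ℝ) :
    A.charpoly.rootMultiplicity (r : ℂ) = (Finset.univ.filter fun j => hA.eigenvalues j = r).card := by
  rw [← Polynomial.count_roots, hA.roots_charpoly_eq_eigenvalues, Multiset.count_map,
    Finset.card_def, Finset.filter_val]
  congr 1
  refine Multiset.filter_congr fun j _ => ?_
  exact Complex.ofReal_inj.trans eq_comm

theorem hasEigenvalue_toLin'_ofReal_iff {n : ℕ} {A : Matrix (Fin n) (Fin n) ℂ}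
    (hA : A.IsHermitian) (r : ℝ) :
    Module.End.HasEigenvalue (Matrix.toLin' A) (r : ℂ) ↔ ∃ j, hA.eigenvalues j = r := by
  rw [Module.End.hasEigenvalue_iff_mem_spectrum, Matrix.spectrum_toLin',
    hA.spectrum_eq_image_range]
  simp

/-- Group the indices `j` by the value of their eigenvalue: the fibre over `s i` has `m i` elements.
-/
theorem prod_filter_eigenvalues_eq {n : ℕ} {A : Matrix (Fin n) (Fin n) ℂ} (hA : A.IsHermitian)
    (p : ℝ → Prop) [DecidablePred p] {N : ℕ} {s : ℕ → ℝ} {m : ℕ → ℕ}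
    (hinj : Set.InjOn s (Set.Icc 1 N))
    (himage : s '' Set.Icc 1 N =
      {r : ℝ | p r ∧ Module.End.HasEigenvalue (Matrix.toLin' A) (r : ℂ)})
    (hm : ∀ i ∈ Set.Icc 1 N, m i = A.charpoly.rootMultiplicity (s i : ℂ)) (f : ℝ → ℂ) :
    ∏ j with p (hA.eigenvalues j), f (hA.eigenvalues j) = ∏ i ∈ Finset.Icc 1 N, f (s i) ^ m i := by
  have hmaps : ∀ j ∈ Finset.univ.filter (fun j => p (hA.eigenvalues j)),
      hA.eigenvalues j ∈ (Finset.Icc 1 N).image s := by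
    intro j hj
    have hmem : hA.eigenvalues j ∈ s '' Set.Icc 1 N := by
      rw [himage]
      exact ⟨(Finset.mem_filter.1 hj).2, (hasEigenvalue_toLin'_ofReal_iff hA _).2 ⟨j, rfl⟩⟩
    rw [← Finset.mem_coe, Finset.coe_image, Finset.coe_Icc]
    exact hmem
  rw [← Finset.prod_fiberwise_of_maps_to' hmaps, Finset.prod_image (by simpa using hinj)]
  refine Finset.prod_congr rfl fun i hi => ?_
  have hi' : i ∈ Set.Icc 1 N := by simpa using hi
  have hp : p (s i) := (himage.subset ⟨i, hi', rfl⟩).1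
  rw [Finset.prod_const, hm i hi', rootMultiplicity_charpoly_eq_card_eigenvalues hA,
    Finset.filter_filter]
  congr 2
  refine Finset.filter_congr fun j _ => ⟨fun h => h.2, fun h => ⟨h ▸ hp, h⟩⟩

/-! ### Tails in terms of scales, and mixtures of Erlang differences -/

theorem erlangDiff_inv_real_Ioi (n n' : ℕ) {a b t : ℝ} (ha : 0 < a) (hb : 0 < b) (ht : 0 ≤ t) :
    (erlangDiff n a⁻¹ n' b⁻¹).real (Set.Ioi t) =
      ∑ i ∈ Finset.range (n + 1), Real.exp (-(t / a)) / (i.factorial : ℝ) * (b / a) ^ i *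
        ∑ l ∈ Finset.range (i + 1), (i.choose l : ℝ) * (t / b) ^ (i - l) *
          (Real.Gamma ((n' + 1 + l : ℕ) : ℝ) / Real.Gamma ((n' + 1 : ℕ) : ℝ)) *
          (a / (a + b)) ^ (n' + 1 + l) := by
  rw [erlangDiff_real_Ioi n n' (inv_pos.2 ha) (inv_pos.2 hb) ht]
  refine Finset.sum_congr rfl fun i _ => ?_
  rw [Finset.mul_sum]
  refine Finset.sum_congr rfl fun l hl => ?_
  -- Writing `i = d + l` removes the truncated subtraction in the exponent.
  obtain ⟨d, rfl⟩ : ∃ d, i = d + l := ⟨i - l, by have := Finset.mem_range.1 hl; omega⟩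
  have hsum : a⁻¹ + b⁻¹ = (a + b) / (a * b) := by
    field_simp
    ring
  have hG1 : Real.Gamma ((n' + 1 + l : ℕ) : ℝ) = (n' + l).factorial := by
    rw [← Real.Gamma_nat_eq_factorial]
    push_cast
    ring_nf
  have hG2 : Real.Gamma ((n' + 1 : ℕ) : ℝ) = n'.factorial := by
    rw [← Real.Gamma_nat_eq_factorial]
    push_cast
    rfl
  have hab : a + b ≠ 0 := (add_pos ha hb).ne'
  have hn : (n'.factorial : ℝ) ≠ 0 := by positivity
  have hd : ((d + l).factorial : ℝ) ≠ 0 := by positivity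
  rw [hG1, hG2, hsum, Nat.add_sub_cancel, inv_mul_eq_div]
  simp only [div_pow, inv_pow, mul_pow, pow_add]
  field_simp

/-- At `t = 0` the expansion variable is `w = 1`, so its absolute convergence there is summability
of the weights. -/
theorem mosDeltaBar_summable {n : ℕ} {s : ℕ → ℝ} {m : ℕ → ℕ}
    (hs : ∀ i ∈ Finset.Icc 1 n, 0 < s 1 / s i ∧ s 1 / s i ≤ 1) : Summable (mosDeltaBar n s m) := by
  have h := (mosDeltaBar_charFun (m := m) hs 0).1
  simpa [Complex.norm_real, summable_abs_iff] using h

/-- The mixture of differences of independent Erlang laws with scales `a` and `b`, shapes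
`p + 1 + k.1` and `q + 1 + k.2`, and weights `c k`. -/
noncomputable def erlangDiffMixture (c : ℕ × ℕ → ℝ) (p q : ℕ) (a b : ℝ) : Measure ℝ :=
  Measure.sum fun k : ℕ × ℕ =>
    ENNReal.ofReal (c k) • erlangDiff (p + k.1) a⁻¹ (q + k.2) b⁻¹

theorem isFiniteMeasure_erlangDiffMixture {c : ℕ × ℕ → ℝ} (hc : Summable c)
    (p q : ℕ) {a b : ℝ} (ha : 0 < a) (hb : 0 < b) :
    IsFiniteMeasure (erlangDiffMixture c p q a b) := by
  refine ⟨?_⟩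
  rw [erlangDiffMixture, Measure.sum_apply _ MeasurableSet.univ]
  have : ∀ k : ℕ × ℕ, (ENNReal.ofReal (c k) •
      erlangDiff (p + k.1) a⁻¹ (q + k.2) b⁻¹) Set.univ = ENNReal.ofReal (c k) := by
    intro k
    have := isProbabilityMeasure_erlangDiff (p + k.1) (q + k.2) (inv_pos.2 ha) (inv_pos.2 hb)
    rw [Measure.smul_apply, measure_univ, smul_eq_mul, mul_one]
  simp_rw [this]
  exact hc.tsum_ofReal_lt_top

/-- The integrand has modulus `1` and the mixture is finite, so the integral may be taken component
by component. -/
theorem hasSum_charFun_erlangDiffMixture {c : ℕ × ℕ → ℝ} (hc0 : ∀ k, 0 ≤ c k) (hc : Summable c)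
    (p q : ℕ) {a b : ℝ} (ha : 0 < a) (hb : 0 < b) (t : ℝ) :
    HasSum (fun k : ℕ × ℕ => (c k : ℂ) *
      ((1 - (t * a : ℝ) * Complex.I : ℂ)⁻¹ ^ (p + k.1 + 1) *
        (1 - (t * -b : ℝ) * Complex.I : ℂ)⁻¹ ^ (q + k.2 + 1)))
      (charFun (erlangDiffMixture c p q a b) t) := by
  have hfin := isFiniteMeasure_erlangDiffMixture hc p q ha hb
  have hint : Integrable (fun x : ℝ => Complex.exp (t * x * Complex.I))
      (erlangDiffMixture c p q a b) := by
    refine (integrable_const (1 : ℝ)).mono' (Continuous.aestronglyMeasurable (by fun_prop))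
      (ae_of_all _ fun x => ?_)
    rw [← Complex.ofReal_mul, Complex.norm_exp_ofReal_mul_I]
  have h := hasSum_integral_measure hint
  rw [charFun_apply_real]
  refine h.congr_fun fun k => ?_
  have hk := charFun_erlangDiff (p + k.1) (q + k.2) (inv_pos.2 ha) (inv_pos.2 hb) t
  rw [inv_inv, inv_inv, charFun_apply_real] at hk
  rw [integral_smul_measure, ENNReal.toReal_ofReal (hc0 k), hk, Complex.real_smul]

theorem hasSum_erlangDiffMixture_real_Ioi {c : ℕ × ℕ → ℝ} (hc0 : ∀ k, 0 ≤ c k) (hc : Summable c)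
    (p q : ℕ) {a b : ℝ} (ha : 0 < a) (hb : 0 < b) (t : ℝ) :
    HasSum (fun k : ℕ × ℕ => c k * (erlangDiff (p + k.1) a⁻¹ (q + k.2) b⁻¹).real (Set.Ioi t))
      ((erlangDiffMixture c p q a b).real (Set.Ioi t)) := by
  have hfin := isFiniteMeasure_erlangDiffMixture hc p q ha hb
  have htop := measure_ne_top (erlangDiffMixture c p q a b) (Set.Ioi t)
  rw [measureReal_def]
  rw [erlangDiffMixture, Measure.sum_apply _ measurableSet_Ioi] at htop ⊢
  rw [ENNReal.tsum_toReal_eq (ENNReal.ne_top_of_tsum_ne_top htop)]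
  refine (ENNReal.hasSum_toReal htop).congr_fun fun k => ?_
  rw [Measure.smul_apply, smul_eq_mul, ENNReal.toReal_mul, ENNReal.toReal_ofReal (hc0 k),
    measureReal_def]

/-- Nonemptiness of the group makes `s 1` an actual eigenvalue and allows `ρ = p + 1`, the form
required by Erlang shapes `n + 1`. -/
theorem one_le_and_one_le_mosRho {n : ℕ} {A : Matrix (Fin n) (Fin n) ℂ} (hA : A.IsHermitian)
    {p : ℝ → Prop} (hp : ∃ j, p (hA.eigenvalues j)) {N : ℕ} {s : ℕ → ℝ} {m : ℕ → ℕ}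
    (himage : s '' Set.Icc 1 N =
      {r : ℝ | p r ∧ Module.End.HasEigenvalue (Matrix.toLin' A) (r : ℂ)})
    (hm : ∀ i ∈ Set.Icc 1 N, m i = A.charpoly.rootMultiplicity (s i : ℂ)) :
    1 ≤ N ∧ 1 ≤ mosRho N m := by
  obtain ⟨j, hj⟩ := hp
  obtain ⟨i, hi, his⟩ := himage.superset ⟨hj, (hasEigenvalue_toLin'_ofReal_iff hA _).2 ⟨j, rfl⟩⟩
  refine ⟨hi.1.trans hi.2, ?_⟩
  have h1 : 1 ≤ m i := by
    rw [hm i hi, rootMultiplicity_charpoly_eq_card_eigenvalues hA, Nat.one_le_iff_ne_zero,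
      Finset.card_ne_zero]
    exact ⟨j, by simp [his]⟩
  exact h1.trans (Finset.single_le_sum (f := m) (fun _ _ => Nat.zero_le _) (by simpa using hi))

/-! ### The law of the form and its tail -/

/-- An indefinite Hermitian form in a standard complex Gaussian vector is distributed as a mixture
of differences of independent Erlang variables. -/
theorem map_hermForm_complexGaussian_eq_erlangDiffMixture {L : ℕ}
    [IsProbabilityMeasure (complexGaussian (0 : Fin L → ℂ) 1)] {Ω : Matrix (Fin L) (Fin L) ℂ}
    (hΩ : Ω.IsHermitian) {n₁ : ℕ} {s₁ : ℕ → ℝ} {m₁ : ℕ → ℕ}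
    (hs₁ : Set.InjOn s₁ (Set.Icc 1 n₁))
    (hs₁_image : s₁ '' Set.Icc 1 n₁ =
      {r : ℝ | 0 < r ∧ Module.End.HasEigenvalue (Matrix.toLin' Ω) (r : ℂ)})
    (hm₁ : ∀ i ∈ Set.Icc 1 n₁, m₁ i = Ω.charpoly.rootMultiplicity (s₁ i : ℂ))
    (hr₁ : ∀ i ∈ Finset.Icc 1 n₁, 0 < s₁ 1 / s₁ i ∧ s₁ 1 / s₁ i ≤ 1) (hpos : 0 < s₁ 1)
    {n₂ : ℕ} {s₂ : ℕ → ℝ} {m₂ : ℕ → ℕ}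
    (hs₂ : Set.InjOn s₂ (Set.Icc 1 n₂))
    (hs₂_image : s₂ '' Set.Icc 1 n₂ =
      {r : ℝ | r < 0 ∧ Module.End.HasEigenvalue (Matrix.toLin' Ω) (r : ℂ)})
    (hm₂ : ∀ i ∈ Set.Icc 1 n₂, m₂ i = Ω.charpoly.rootMultiplicity (s₂ i : ℂ))
    (hr₂ : ∀ i ∈ Finset.Icc 1 n₂, 0 < s₂ 1 / s₂ i ∧ s₂ 1 / s₂ i ≤ 1) (hneg : s₂ 1 < 0)
    {p q : ℕ} (hp : mosRho n₁ m₁ = p + 1) (hq : mosRho n₂ m₂ = q + 1) :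
    (complexGaussian 0 1).map (hermForm Ω) = erlangDiffMixture
      (fun k => mosDeltaBar n₁ s₁ m₁ k.1 * mosDeltaBar n₂ s₂ m₂ k.2) p q (s₁ 1) (-s₂ 1) := by
  have hc0 : ∀ k : ℕ × ℕ, 0 ≤ mosDeltaBar n₁ s₁ m₁ k.1 * mosDeltaBar n₂ s₂ m₂ k.2 := fun k =>
    mul_nonneg (mosDeltaBar_nonneg hr₁ _) (mosDeltaBar_nonneg hr₂ _)
  have hc : Summable fun k : ℕ × ℕ => mosDeltaBar n₁ s₁ m₁ k.1 * mosDeltaBar n₂ s₂ m₂ k.2 :=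
    (mosDeltaBar_summable hr₁).mul_of_nonneg (mosDeltaBar_summable hr₂)
      (mosDeltaBar_nonneg hr₁) (mosDeltaBar_nonneg hr₂)
  have hb : 0 < -s₂ 1 := neg_pos.2 hneg
  have := isFiniteMeasure_erlangDiffMixture hc p q hpos hb
  have hmeas := (continuous_hermForm Ω).measurable
  have := Measure.isProbabilityMeasure_map (μ := complexGaussian 0 1) hmeas.aemeasurable
  refine Measure.ext_of_charFun (funext fun t => ?_)
  rw [← (hasSum_charFun_erlangDiffMixture hc0 hc p q hpos hb t).tsum_eq, neg_neg,
    charFun_apply_real, integral_map hmeas.aemeasurable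
      (Continuous.aestronglyMeasurable (by fun_prop)),
    integral_cexp_hermForm_complexGaussian hΩ]
  obtain ⟨hsum₁, heq₁⟩ := mosDeltaBar_charFun (m := m₁) hr₁ t
  obtain ⟨hsum₂, heq₂⟩ := mosDeltaBar_charFun (m := m₂) hr₂ t
  have hterm : ∀ k : ℕ × ℕ,
      ((mosDeltaBar n₁ s₁ m₁ k.1 * mosDeltaBar n₂ s₂ m₂ k.2 : ℝ) : ℂ) *
        ((1 - (t * s₁ 1 : ℝ) * Complex.I : ℂ)⁻¹ ^ (p + k.1 + 1) *
          (1 - (t * s₂ 1 : ℝ) * Complex.I : ℂ)⁻¹ ^ (q + k.2 + 1)) =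
      ((mosDeltaBar n₁ s₁ m₁ k.1 : ℂ) *
        (1 - (t * s₁ 1 : ℝ) * Complex.I : ℂ)⁻¹ ^ (mosRho n₁ m₁ + k.1)) *
      ((mosDeltaBar n₂ s₂ m₂ k.2 : ℂ) *
        (1 - (t * s₂ 1 : ℝ) * Complex.I : ℂ)⁻¹ ^ (mosRho n₂ m₂ + k.2)) := by
    intro k
    rw [hp, hq, add_right_comm p 1, add_right_comm q 1, Complex.ofReal_mul]
    ring
  rw [tsum_congr hterm, ← tsum_mul_tsum_of_summable_norm hsum₁ hsum₂, heq₁, heq₂]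
  rw [← prod_filter_eigenvalues_eq hΩ (fun r => 0 < r) hs₁ hs₁_image hm₁
      (fun r => (1 - (t * r : ℝ) * Complex.I : ℂ)⁻¹),
    ← prod_filter_eigenvalues_eq hΩ (fun r => r < 0) hs₂ hs₂_image hm₂
      (fun r => (1 - (t * r : ℝ) * Complex.I : ℂ)⁻¹),
    Finset.prod_filter, Finset.prod_filter, ← Finset.prod_mul_distrib]
  refine Finset.prod_congr rfl fun j _ => ?_
  -- Each nonzero eigenvalue belongs to exactly one group; a zero eigenvalue belongs to neither, and
  -- its factor is `1`.
  rcases lt_trichotomy (hΩ.eigenvalues j) 0 with h | h | h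
  · simp [h, h.not_gt]
  · simp [h]
  · simp [h, h.not_gt]

theorem mainTheorem7 {S : Type*} [MeasurableSpace S] (P : Measure S) [IsProbabilityMeasure P]
    {L : ℕ} (Ω : Matrix (Fin L) (Fin L) ℂ) (hΩ : IsIndefiniteHermitian Ω)
    (x : S → Fin L → ℂ) (hx : HasLaw x (complexGaussian 0 1) P)
    -- `s₁ 1 < ⋯ < s₁ n₁` are the distinct positive eigenvalues, with algebraic multiplicities `m₁ i`
    (n₁ : ℕ) (s₁ : ℕ → ℝ) (m₁ : ℕ → ℕ)
    (hs₁ : StrictMonoOn s₁ (Set.Icc 1 n₁))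
    (hs₁_image : s₁ '' Set.Icc 1 n₁ =
      {r : ℝ | 0 < r ∧ Module.End.HasEigenvalue (Matrix.toLin' Ω) (r : ℂ)})
    (hm₁ : ∀ i ∈ Set.Icc 1 n₁, m₁ i = Ω.charpoly.rootMultiplicity (s₁ i : ℂ))
    -- `s₂ n₂ < ⋯ < s₂ 1` are the distinct negative eigenvalues, with algebraic multiplicities `m₂ i`
    (n₂ : ℕ) (s₂ : ℕ → ℝ) (m₂ : ℕ → ℕ)
    (hs₂ : StrictAntiOn s₂ (Set.Icc 1 n₂))
    (hs₂_image : s₂ '' Set.Icc 1 n₂ =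
      {r : ℝ | r < 0 ∧ Module.End.HasEigenvalue (Matrix.toLin' Ω) (r : ℂ)})
    (hm₂ : ∀ i ∈ Set.Icc 1 n₂, m₂ i = Ω.charpoly.rootMultiplicity (s₂ i : ℂ)) :
    (∀ t : ℝ, 0 ≤ t →
      HasSum (fun k : ℕ × ℕ =>
        mosDeltaBar n₁ s₁ m₁ k.1 * mosDeltaBar n₂ s₂ m₂ k.2 *
          ∑ i ∈ Finset.range (mosRho n₁ m₁ + k.1),
            Real.exp (-(t / |s₁ 1|)) / (i.factorial : ℝ) * |s₂ 1 / s₁ 1| ^ i *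
              ∑ l ∈ Finset.range (i + 1),
                (i.choose l : ℝ) * (t / |s₂ 1|) ^ (i - l) *
                  (Real.Gamma ((mosRho n₂ m₂ + k.2 + l : ℕ) : ℝ) /
                    Real.Gamma ((mosRho n₂ m₂ + k.2 : ℕ) : ℝ)) *
                  (|s₁ 1| / (|s₁ 1| + |s₂ 1|)) ^ (mosRho n₂ m₂ + k.2 + l))
        (P.real {ω | t < hermForm Ω (x ω)})) ∧
    HasSum (fun k : ℕ × ℕ =>
      mosDeltaBar n₁ s₁ m₁ k.1 * mosDeltaBar n₂ s₂ m₂ k.2 *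
        ∑ i ∈ Finset.range (mosRho n₁ m₁ + k.1),
          1 / (i.factorial : ℝ) *
            (Real.Gamma ((mosRho n₂ m₂ + k.2 + i : ℕ) : ℝ) /
              Real.Gamma ((mosRho n₂ m₂ + k.2 : ℕ) : ℝ)) *
            |s₂ 1 / s₁ 1| ^ i *
            (|s₁ 1| / (|s₁ 1| + |s₂ 1|)) ^ (mosRho n₂ m₂ + k.2 + i))
      (P.real {ω | 0 < hermForm Ω (x ω)}) := by
  obtain ⟨hherm, ⟨v, hv⟩, w, hw⟩ := hΩ
  obtain ⟨hn₁, hρ₁⟩ := one_le_and_one_le_mosRho hherm (exists_eigenvalues_pos hherm hv)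
    hs₁_image hm₁
  obtain ⟨hn₂, hρ₂⟩ := one_le_and_one_le_mosRho (p := fun r => r < 0) hherm
    (exists_eigenvalues_neg hherm hw) hs₂_image hm₂
  have hs₁_pos : ∀ i ∈ Set.Icc 1 n₁, 0 < s₁ i := fun i hi =>
    (hs₁_image.subset ⟨i, hi, rfl⟩).1
  have hs₂_neg : ∀ i ∈ Set.Icc 1 n₂, s₂ i < 0 := fun i hi =>
    (hs₂_image.subset ⟨i, hi, rfl⟩).1
  have ha : 0 < s₁ 1 := hs₁_pos 1 ⟨le_rfl, hn₁⟩
  have hb : s₂ 1 < 0 := hs₂_neg 1 ⟨le_rfl, hn₂⟩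
  -- In both groups `s 1` has the smallest modulus, so the ratios lie in `(0, 1]`.
  have hr₁ : ∀ i ∈ Finset.Icc 1 n₁, 0 < s₁ 1 / s₁ i ∧ s₁ 1 / s₁ i ≤ 1 := by
    intro i hi
    have hi' : i ∈ Set.Icc 1 n₁ := by simpa using hi
    exact ⟨div_pos ha (hs₁_pos i hi'), (div_le_one (hs₁_pos i hi')).2
      (hs₁.monotoneOn ⟨le_rfl, hn₁⟩ hi' hi'.1)⟩
  have hr₂ : ∀ i ∈ Finset.Icc 1 n₂, 0 < s₂ 1 / s₂ i ∧ s₂ 1 / s₂ i ≤ 1 := by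
    intro i hi
    have hi' : i ∈ Set.Icc 1 n₂ := by simpa using hi
    exact ⟨div_pos_of_neg_of_neg hb (hs₂_neg i hi'), (div_le_one_of_neg (hs₂_neg i hi')).2
      (hs₂.antitoneOn ⟨le_rfl, hn₂⟩ hi' hi'.1)⟩
  obtain ⟨p, hp⟩ := Nat.exists_eq_add_of_le' hρ₁
  obtain ⟨q, hq⟩ := Nat.exists_eq_add_of_le' hρ₂
  -- The total mass is `1` because this measure is the law of `x`; no Gaussian integral is needed.
  have hprob : IsProbabilityMeasure (complexGaussian (0 : Fin L → ℂ) 1) :=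
    hx.map_eq ▸ Measure.isProbabilityMeasure_map hx.aemeasurable
  have hlaw := map_hermForm_complexGaussian_eq_erlangDiffMixture hherm hs₁.injOn hs₁_image hm₁ hr₁
    ha hs₂.injOn hs₂_image hm₂ hr₂ hb hp hq
  have habs₁ : |s₁ 1| = s₁ 1 := abs_of_pos ha
  have habs₂ : |s₂ 1| = -s₂ 1 := abs_of_neg hb
  have hmeas := (continuous_hermForm Ω).measurable
  have main : ∀ t : ℝ, 0 ≤ t →
      HasSum (fun k : ℕ × ℕ =>
        mosDeltaBar n₁ s₁ m₁ k.1 * mosDeltaBar n₂ s₂ m₂ k.2 *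
          ∑ i ∈ Finset.range (mosRho n₁ m₁ + k.1),
            Real.exp (-(t / |s₁ 1|)) / (i.factorial : ℝ) * |s₂ 1 / s₁ 1| ^ i *
              ∑ l ∈ Finset.range (i + 1),
                (i.choose l : ℝ) * (t / |s₂ 1|) ^ (i - l) *
                  (Real.Gamma ((mosRho n₂ m₂ + k.2 + l : ℕ) : ℝ) /
                    Real.Gamma ((mosRho n₂ m₂ + k.2 : ℕ) : ℝ)) *
                  (|s₁ 1| / (|s₁ 1| + |s₂ 1|)) ^ (mosRho n₂ m₂ + k.2 + l))
        (P.real {ω | t < hermForm Ω (x ω)}) := by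
    intro t ht
    have hset : P.real {ω | t < hermForm Ω (x ω)} =
        ((complexGaussian 0 1).map (hermForm Ω)).real (Set.Ioi t) := by
      rw [measureReal_def, measureReal_def, Measure.map_apply hmeas measurableSet_Ioi, ← hx.map_eq,
        Measure.map_apply_of_aemeasurable hx.aemeasurable (hmeas measurableSet_Ioi)]
      rfl
    rw [hset, hlaw]
    refine (hasSum_erlangDiffMixture_real_Ioi
      (fun k => mul_nonneg (mosDeltaBar_nonneg hr₁ _) (mosDeltaBar_nonneg hr₂ _))
      ((mosDeltaBar_summable hr₁).mul_of_nonneg (mosDeltaBar_summable hr₂)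
        (mosDeltaBar_nonneg hr₁) (mosDeltaBar_nonneg hr₂)) p q ha (neg_pos.2 hb) t).congr_fun
      fun k => ?_
    rw [erlangDiff_inv_real_Ioi _ _ ha (neg_pos.2 hb) ht, abs_div, habs₁, habs₂, hp, hq,
      add_right_comm p 1, add_right_comm q 1]
  refine ⟨main, (main 0 le_rfl).congr_fun fun k => ?_⟩
  congr 1
  refine Finset.sum_congr rfl fun i _ => ?_
  -- At `t = 0` the factor `0 ^ (i - l)` kills every term except `l = i`, where it is `0 ^ 0 = 1`.
  rw [Finset.sum_range_succ, Finset.sum_eq_zero fun l hl => ?_]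
  · simp
    ring
  · have := Finset.mem_range.1 hl
    simp [show i - l ≠ 0 by omega]
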